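/- For a finite simple graph $G$ with a linear order on its vertices and an integer $p \ge 0$, let $P_p(G)$ be the set of simple paths $v_0 v_1 \dots v_k$ in $G$ (the $v_i$ are distinct and consecutive ones are adjacent) with $0 \le k \le p$, where a path and its reverse are identified (the representative with $v_0 < v_k$ is kept if $k \ge 1$). For $\sigma,\tau \in P_p(G)$ write $\sigma \prec \tau$ if $\sigma$ arises from $\tau$ by omitting one vertex of the sequence, up to reversal, and let $$\mathcal B(\sigma)=\{\tau : \tau \prec \sigma\},\quad \mathcal C(\sigma)=\{\tau : \sigma \prec \tau\},\quad \mathcal N_\uparrow(\sigma)=\{\tau : \sigma\prec\delta \text{ and } \tau\prec\delta \text{ for some } \delta \in P_p(G)\}.$$ The path Weisfeiler–Lehman test $\mathrm{PWL}$ of dimension $p$ gives all elements of $P_p(G)$ the same initial colour and updates $$c^{t+1}_\sigma=\mathrm{Hash}\Big(c^t_\sigma,\ \{\!\!\{c^t_\tau : \tau\in\mathcal B(\sigma)\}\!\!\},\ \{\!\!\{(c^t_\tau,c^t_\delta) : \tau\in\mathcal N_\uparrow(\sigma),\ \delta\in\mathcal C(\sigma)\cap\mathcal C(\tau)\}\!\!\}\Big)$$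 with an injective $\mathrm{Hash}$. The $3$-dimensional Weisfeiler–Lehman test ($3$-WL, not the folklore variant) colours triples $v$ of vertices, initially by their isomorphism type (which entries are equal and which are adjacent), and updates $$c^{t+1}_v=\mathrm{Hash}\Big(c^t_v,\ \big(\{\!\!\{c^t_{v[u/j]} : u\in V(G)\}\!\!\}\big)_{j=1,2,3}\Big)$$ with an injective $\mathrm{Hash}$, where $v[u/j]$ is $v$ with its $j$-th entry replaced by $u$. Either test, run on two graphs in parallel, distinguishes them if the colour histograms of the two graphs differ once the joint colouring of both graphs is stable (the next update splits no colour class). Then $\mathrm{PWL}$ is not less powerful than $3$-WL at distinguishing non-isomorphic graphs: there are two non-isomorphic strongly regular graphs with the same parameters that are distinguished by $\mathrm{PWL}$ of dimension $p$ for every $p \ge 3$, but are not distinguished by $3$-WL. -/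

import Mathlib

/-! ### Running a colour refinement on two structures in parallel

A colour refinement run assigns to every time step `t` a colouring of the coloured objects, with
colours in a palette `C t`. The palettes below are built so that the injective map `Hash` is simply
the formation of a tuple; two objects (of the same or of different structures) receive the same
colour exactly when they do so for any other injective choice of `Hash`. -/

/-- The two runs `c` and `d` are stable at time `t`: the next step does not split any colour class
of the disjoint union of the two structures. -/
def StableAt {C : ℕ → Type} {X Y : Type*} (c : (t : ℕ) → X → C t) (d : (t : ℕ) → Y → C t)
    (t : ℕ) : Prop :=
  ∀ a b : X ⊕ Y, Sum.elim (c t) (d t) a = Sum.elim (c t) (d t) b →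
    Sum.elim (c (t + 1)) (d (t + 1)) a = Sum.elim (c (t + 1)) (d (t + 1)) b

/-- The colour histogram of a finite structure. -/
def colorHistogram {K X : Type*} [Fintype X] (c : X → K) : Multiset K :=
  (Finset.univ : Finset X).val.map c

/-- The two runs are distinguished: their stable colour histograms differ. -/
def DistinguishedBy {C : ℕ → Type} {X Y : Type*} [Fintype X] [Fintype Y]
    (c : (t : ℕ) → X → C t) (d : (t : ℕ) → Y → C t) : Prop :=
  ∃ t, StableAt c d t ∧ colorHistogram (c t) ≠ colorHistogram (d t)

/-! ### The path complex of a graph -/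

/-- The elementary paths of the path complex of highest dimension `p` that arises from `G`: simple
paths with at least one and at most `p + 1` vertices. A path and its reverse are identified, by
keeping the sequence whose first vertex is not larger than its last one (the two are equal only
for a path with one vertex). -/
def ElemPath {V : Type*} [LinearOrder V] (G : SimpleGraph V) (p : ℕ) : Type _ :=
  {l : List V // l.length ≤ p + 1 ∧ l.Nodup ∧ l.IsChain G.Adj ∧
    ∃ h : l ≠ [], l.head h ≤ l.getLast h}

instance ElemPath.instFinite {V : Type*} [LinearOrder V] [Finite V] (G : SimpleGraph V) (p : ℕ) :
    Finite (ElemPath G p) := by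
  have := Fintype.ofFinite V
  exact Finite.of_injective
    (fun s : ElemPath G p => (⟨s.1, s.2.2.1⟩ : {l : List V // l.Nodup}))
    (fun s s' h => Subtype.ext (congrArg (fun l : {l : List V // l.Nodup} => l.1) h))

noncomputable instance ElemPath.instFintype {V : Type*} [LinearOrder V] [Finite V]
    (G : SimpleGraph V) (p : ℕ) : Fintype (ElemPath G p) :=
  Fintype.ofFinite _

/-- `σ ≺ τ`: the sequence `σ` arises from `τ` by omitting one vertex, up to reversal. -/
def ElemPath.IsBoundary {V : Type*} [LinearOrder V] {G : SimpleGraph V} {p : ℕ}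
    (σ τ : ElemPath G p) : Prop :=
  ∃ i < τ.1.length, σ.1 = τ.1.eraseIdx i ∨ σ.1 = (τ.1.eraseIdx i).reverse

open Classical in
/-- The set of boundaries of `σ`. -/
noncomputable def ElemPath.boundary {V : Type*} [LinearOrder V] [Finite V] {G : SimpleGraph V}
    {p : ℕ} (σ : ElemPath G p) : Finset (ElemPath G p) :=
  Finset.univ.filter fun τ => τ.IsBoundary σ

open Classical in
/-- The set of co-boundaries of `σ`. -/
noncomputable def ElemPath.coboundary {V : Type*} [LinearOrder V] [Finite V] {G : SimpleGraph V}
    {p : ℕ} (σ : ElemPath G p) : Finset (ElemPath G p) :=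
  Finset.univ.filter fun τ => σ.IsBoundary τ

open Classical in
/-- The upper-adjacent neighbourhood `{τ | σ ≺ δ and τ ≺ δ for some δ}` of `σ`. -/
noncomputable def ElemPath.upperNeighbors {V : Type*} [LinearOrder V] [Finite V]
    {G : SimpleGraph V} {p : ℕ} (σ : ElemPath G p) : Finset (ElemPath G p) :=
  Finset.univ.filter fun τ => ∃ δ, σ.IsBoundary δ ∧ τ.IsBoundary δ

open Classical in
/-- The pairs `(τ, δ)` of an upper-adjacent neighbour `τ` of `σ` and a common co-boundary `δ` of
`σ` and `τ`. -/
noncomputable def ElemPath.upperPairs {V : Type*} [LinearOrder V] [Finite V]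
    {G : SimpleGraph V} {p : ℕ} (σ : ElemPath G p) : Finset (ElemPath G p × ElemPath G p) :=
  Finset.univ.filter fun x => x.1 ∈ σ.upperNeighbors ∧ x.2 ∈ σ.coboundary ∩ x.1.coboundary

/-! ### The path Weisfeiler-Lehman test -/

/-- The colours of the path Weisfeiler-Lehman test after `t` steps. -/
def PWLColor : ℕ → Type
  | 0 => Unit
  | t + 1 => PWLColor t × Multiset (PWLColor t) × Multiset (PWLColor t × PWLColor t)

/-- The path colouring after `t` steps: all elementary paths start with the same colour, and the
new colour of `σ` is made of its colour, the multiset of the colours of its boundaries, and the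
multiset of the colour pairs of its upper-adjacent neighbours and the common co-boundaries. -/
noncomputable def pwlColoring {V : Type*} [LinearOrder V] [Finite V] (G : SimpleGraph V)
    (p : ℕ) : (t : ℕ) → ElemPath G p → PWLColor t
  | 0, _ => ()
  | t + 1, σ =>
    (pwlColoring G p t σ,
      σ.boundary.val.map (pwlColoring G p t),
      σ.upperPairs.val.map fun x => (pwlColoring G p t x.1, pwlColoring G p t x.2))

/-- The path Weisfeiler-Lehman test on path complexes of highest dimension `p` distinguishes the
graphs `G` and `H`. -/
def PWLDistinguishes {V W : Type*} [LinearOrder V] [Finite V] [LinearOrder W] [Finite W] (p : ℕ)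
    (G : SimpleGraph V) (H : SimpleGraph W) : Prop :=
  DistinguishedBy (pwlColoring G p) (pwlColoring H p)

/-! ### The `k`-dimensional Weisfeiler-Lehman test (not the folklore variant), for `k ≥ 2` -/

/-- The colours of the `k`-dimensional Weisfeiler-Lehman test after `t` steps. The initial colours
are pairs of relations on the positions of a `k`-tuple, equality and adjacency. -/
def WLColor (k : ℕ) : ℕ → Type
  | 0 => Fin k → Fin k → Prop × Prop
  | t + 1 => WLColor k t × (Fin k → Multiset (WLColor k t))

/-- The colouring of `k`-tuples of vertices after `t` steps: a tuple starts with its isomorphism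
type (two tuples start with the same colour exactly if matching their entries is a partial
isomorphism), and its new colour is made of its colour and, for every position `j`, the multiset
of the colours of the tuples that arise by replacing the entry at position `j` by any vertex. -/
def wlColoring {V : Type*} [DecidableEq V] [Fintype V] (G : SimpleGraph V) (k : ℕ) :
    (t : ℕ) → (Fin k → V) → WLColor k t
  | 0, v => fun i j => (v i = v j, G.Adj (v i) (v j))
  | t + 1, v =>
    (wlColoring G k t v,
      fun j => (Finset.univ : Finset V).val.map fun u => wlColoring G k t (Function.update v j u))

/-- The `k`-dimensional Weisfeiler-Lehman test distinguishes the graphs `G` and `H`. -/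
def WLDistinguishes {V W : Type*} [DecidableEq V] [Fintype V] [DecidableEq W] [Fintype W] (k : ℕ)
    (G : SimpleGraph V) (H : SimpleGraph W) : Prop :=
  DistinguishedBy (wlColoring G k) (wlColoring H k)

/-!
The two graphs are the rook's graph of the `4 × 4` board and the Shrikhande graph, both strongly
regular with parameters `(16, 6, 2, 2)`. A row of the board is a clique with four vertices, and the
Shrikhande graph has no such clique; this separates the graphs up to isomorphism, and it is also
what the path test sees.

*The path test finds cliques* (`isCliqueColor_pwlColoring_iff`). Already the boundary part of the
colours determines whether a path runs through a clique: a path with `n + 1` vertices has at most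
`n + 1` boundaries, one for each omitted vertex, and in a clique all omissions leave a path, again
through a clique. Conversely, if all omissions leave paths through cliques, then any two vertices
are adjacent. A graph with a clique on four vertices thus shows a colour after four steps that no
path has in a graph without such a clique, as soon as paths with four vertices are coloured, that is `p ≥ 3`.
Since runs only refine, the histograms stay different until a stable colouring is reached
(`distinguishedBy_of_colorHistogram_ne`).

*The `3`-dimensional test does not distinguish strongly regular graphs with the same parameters*
(`SimpleGraph.IsSRGWith.not_wlDistinguishes_three`). Replacing one entry of a triple keeps the other
two. How many vertices have prescribed equalities and adjacencies to these two depends only on the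
parameters and on whether the two are equal or adjacent, so the colouring by isomorphism types is
stable from the start, across both graphs. The same count shows that both graphs have equally many
triples of each isomorphism type.
-/

/-! ### Stable colourings of refining runs -/

theorem colorHistogram_comp {K L X : Type*} [Fintype X] (f : K → L) (c : X → K) :
    colorHistogram (f ∘ c) = (colorHistogram c).map f := by
  simp [colorHistogram]

/-- The number of colour classes is non-decreasing along a run that only refines, bounded by the
number of coloured objects, and grows strictly at every step that is not stable. -/
theorem exists_stableAt_ge {C : ℕ → Type} {X Y : Type*} [Finite X] [Finite Y]
    {c : (t : ℕ) → X → C t} {d : (t : ℕ) → Y → C t} (π : ∀ t, C (t + 1) → C t)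
    (hc : ∀ t x, π t (c (t + 1) x) = c t x) (hd : ∀ t y, π t (d (t + 1) y) = d t y) (s : ℕ) :
    ∃ t, s ≤ t ∧ StableAt c d t := by
  by_contra! hns
  let r : (t : ℕ) → X ⊕ Y → C t := fun t => Sum.elim (c t) (d t)
  have hr : ∀ t x, π t (r (t + 1) x) = r t x := by
    rintro t (x | y)
    exacts [hc t x, hd t y]
  have himg : ∀ t, π t '' Set.range (r (t + 1)) = Set.range (r t) := fun t => by
    rw [← Set.range_comp]
    exact congrArg Set.range (funext (hr t))
  have hstep : ∀ t, s ≤ t → (Set.range (r t)).ncard < (Set.range (r (t + 1))).ncard := by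
    intro t ht
    refine lt_of_le_of_ne ?_ fun h => hns t ht ?_
    · rw [← himg t]
      exact Set.ncard_image_le (Set.finite_range _)
    · have hinj : Set.InjOn (π t) (Set.range (r (t + 1))) := by
        rw [← Set.ncard_image_iff (Set.finite_range _), himg t, h]
      intro a b hab
      exact hinj ⟨a, rfl⟩ ⟨b, rfl⟩ ((hr t a).trans (hab.trans (hr t b).symm))
  have hgrow : ∀ i, i ≤ (Set.range (r (s + i))).ncard := by
    intro i
    induction i with
    | zero => exact Nat.zero_le _
    | succ i ih => exact Nat.succ_le_of_lt (ih.trans_lt (hstep (s + i) (by omega)))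
  have hbound : ∀ t, (Set.range (r t)).ncard ≤ Nat.card (X ⊕ Y) := fun t => by
    rw [← Set.image_univ, ← Set.ncard_univ]
    exact Set.ncard_image_le Set.finite_univ
  have := (hgrow (Nat.card (X ⊕ Y) + 1)).trans (hbound _)
  omega

/-- Histograms that differ at some time differ ever after, in particular at a stable time. -/
theorem distinguishedBy_of_colorHistogram_ne {C : ℕ → Type} {X Y : Type*} [Fintype X] [Fintype Y]
    {c : (t : ℕ) → X → C t} {d : (t : ℕ) → Y → C t} (π : ∀ t, C (t + 1) → C t)
    (hc : ∀ t x, π t (c (t + 1) x) = c t x) (hd : ∀ t y, π t (d (t + 1) y) = d t y) {s : ℕ}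
    (hs : colorHistogram (c s) ≠ colorHistogram (d s)) : DistinguishedBy c d := by
  obtain ⟨t, hst, ht⟩ := exists_stableAt_ge π hc hd s
  refine ⟨t, ht, ?_⟩
  clear ht
  induction t, hst using Nat.le_induction with
  | base => exact hs
  | succ t _ ih =>
    intro h
    apply ih
    rw [← funext (hc t), ← funext (hd t)]
    have := congrArg (Multiset.map (π t)) h
    rwa [← colorHistogram_comp, ← colorHistogram_comp] at this

/-! ### Boundaries of elementary paths -/

theorem List.exists_mem_eraseIdx_of_three_le_length {V : Type*} {l : List V}
    (h3 : 3 ≤ l.length) {x y : V} (hx : x ∈ l) (hy : y ∈ l) :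
    ∃ i < l.length, x ∈ l.eraseIdx i ∧ y ∈ l.eraseIdx i := by
  obtain ⟨i, hi, rfl⟩ := List.getElem_of_mem hx
  obtain ⟨j, hj, rfl⟩ := List.getElem_of_mem hy
  obtain ⟨k, hk, hki, hkj⟩ : ∃ k < l.length, i ≠ k ∧ j ≠ k := by
    by_contra! h
    have := h 0
    have := h 1
    have := h 2
    omega
  exact ⟨k, hk, List.mem_eraseIdx_iff_getElem.2 ⟨i, hi, hki, rfl⟩,
    List.mem_eraseIdx_iff_getElem.2 ⟨j, hj, hkj, rfl⟩⟩

namespace ElemPath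

variable {V : Type*} [LinearOrder V] {G : SimpleGraph V} {p : ℕ}

theorem ne_nil (σ : ElemPath G p) : σ.1 ≠ [] := σ.2.2.2.2.1

/-- An undirected path has only one representative. -/
theorem eq_of_eq_or_eq_reverse {σ τ : ElemPath G p} {l : List V}
    (hσ : σ.1 = l ∨ σ.1 = l.reverse) (hτ : τ.1 = l ∨ τ.1 = l.reverse) : σ = τ := by
  have key : ∀ σ τ : ElemPath G p, σ.1 = τ.1.reverse → σ = τ := by
    intro σ τ h
    have hn := σ.2.2.1
    obtain ⟨h1, h2⟩ := σ.2.2.2.2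
    obtain ⟨h3, h4⟩ := τ.2.2.2.2
    have hrev : τ.1 = σ.1.reverse := by rw [h, List.reverse_reverse]
    simp only [hrev, List.head_reverse, List.getLast_reverse] at h4
    have hht := le_antisymm h2 h4
    -- The first and the last vertex agree, so the path consists of a single vertex.
    apply Subtype.ext
    rw [hrev]
    rcases hl : σ.1 with _ | ⟨a, l⟩
    · exact absurd hl h1
    · rcases List.eq_nil_or_concat l with rfl | ⟨l', b, rfl⟩
      · rfl
      · simp only [hl] at hht hn
        simp at hht hn
        exact absurd hht hn.1.2
  rcases hσ with hσ | hσ <;> rcases hτ with hτ | hτ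
  · exact Subtype.ext (hσ.trans hτ.symm)
  · exact key _ _ (by rw [hτ, hσ, List.reverse_reverse])
  · exact key _ _ (by rw [hτ, hσ])
  · exact Subtype.ext (hσ.trans hτ.symm)

/-- Every simple path that is short enough is represented, in one of its two directions. -/
theorem exists_of_isChain {l : List V} (hne : l ≠ []) (hlen : l.length ≤ p + 1) (hnd : l.Nodup)
    (hch : l.IsChain G.Adj) : ∃ σ : ElemPath G p, σ.1 = l ∨ σ.1 = l.reverse := by
  rcases le_total (l.head hne) (l.getLast hne) with h | h
  · exact ⟨⟨l, hlen, hnd, hch, hne, h⟩, Or.inl rfl⟩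
  · refine ⟨⟨l.reverse, by simpa using hlen, by simpa using hnd, ?_, by simpa using hne, ?_⟩,
      Or.inr rfl⟩
    · rw [List.isChain_reverse]
      exact hch.imp fun _ _ h => h.symm
    · simpa using h

theorem length_add_one_of_isBoundary {σ τ : ElemPath G p} (h : τ.IsBoundary σ) :
    τ.1.length + 1 = σ.1.length := by
  obtain ⟨i, hi, h⟩ := h
  have := List.length_eraseIdx_of_lt hi
  rcases h with h | h <;> rw [h] <;> (try rw [List.length_reverse]) <;> omega

variable [Finite V]

theorem mem_boundary {σ τ : ElemPath G p} : τ ∈ σ.boundary ↔ τ.IsBoundary σ := by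
  simp [boundary]

theorem length_eq_one_iff_boundary_eq_empty {σ : ElemPath G p} :
    σ.1.length = 1 ↔ σ.boundary = ∅ := by
  have hpos := List.length_pos_iff.2 σ.ne_nil
  constructor
  · intro h
    refine Finset.eq_empty_of_forall_notMem fun τ hτ => ?_
    have := length_add_one_of_isBoundary (mem_boundary.1 hτ)
    have := List.length_pos_iff.2 τ.ne_nil
    omega
  · intro h
    by_contra hne
    have ht : σ.1.tail ≠ [] := by
      intro h'
      have := congrArg List.length h'
      simp at this
      omega
    obtain ⟨τ, hτ⟩ := exists_of_isChain (p := p) ht (by have := σ.2.1; simp; omega)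
      (σ.2.2.1.tail) (σ.2.2.2.1.tail)
    have : τ ∈ σ.boundary := mem_boundary.2 ⟨0, by omega, by simpa using hτ⟩
    simp [h] at this

/-- There is at most one boundary per omitted position. So if there are as many boundaries as
positions, then omitting the vertex at any position leaves a path. -/
theorem exists_mem_boundary_of_length_le_card (σ : ElemPath G p)
    (h : σ.1.length ≤ σ.boundary.card) {i : ℕ} (hi : i < σ.1.length) :
    ∃ τ ∈ σ.boundary, τ.1 = σ.1.eraseIdx i ∨ τ.1 = (σ.1.eraseIdx i).reverse := by
  choose f hf hf' using fun τ : σ.boundary => mem_boundary.1 τ.2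
  let F : σ.boundary → Fin σ.1.length := fun τ => ⟨f τ, hf τ⟩
  have hF : Function.Injective F := by
    intro τ τ' h
    have h' : f τ = f τ' := congrArg Fin.val h
    have := hf' τ'
    rw [← h'] at this
    exact Subtype.ext (eq_of_eq_or_eq_reverse (hf' τ) this)
  have hb : Function.Bijective F := by
    rw [Fintype.bijective_iff_injective_and_card]
    refine ⟨hF, le_antisymm ?_ ?_⟩
    · exact Fintype.card_le_of_injective F hF
    · simpa using h
  obtain ⟨τ, hτ⟩ := hb.2 ⟨i, hi⟩
  refine ⟨τ, τ.2, ?_⟩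
  have h' : f τ = i := congrArg Fin.val hτ
  rw [← h']
  exact hf' τ

end ElemPath

/-! ### Cliques and the path Weisfeiler-Lehman test -/

/-- The colours, after `n + 1` steps, of the paths with `n + 1` pairwise adjacent vertices: for
`n = 0` these paths have no boundary, and otherwise they have as many boundaries as vertices, all
of which are again such paths, with one vertex less. -/
def IsCliqueColor : (n : ℕ) → PWLColor (n + 1) → Prop
  | 0, (_, b, _) => b = 0
  | n + 1, (_, b, _) => n + 2 ≤ b.card ∧ ∀ x ∈ b, IsCliqueColor n x

open ElemPath in
/-- The test recognizes cliques. The colour says that every vertex of the path can be omitted, and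
that what remains is a clique; two vertices lie together in such a remainder if the path has at
least three vertices, and a path with two vertices is an edge. -/
theorem isCliqueColor_pwlColoring_iff {V : Type*} [LinearOrder V] [Finite V] {G : SimpleGraph V}
    {p : ℕ} (n : ℕ) (σ : ElemPath G p) : IsCliqueColor n (pwlColoring G p (n + 1) σ) ↔
      σ.1.length = n + 1 ∧ G.IsClique {x | x ∈ σ.1} := by
  induction n generalizing σ with
  | zero =>
    have h0 : IsCliqueColor 0 (pwlColoring G p 1 σ) ↔ σ.boundary = ∅ :=
      Multiset.map_eq_zero.trans Finset.val_eq_zero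
    rw [h0, ← length_eq_one_iff_boundary_eq_empty, zero_add, iff_self_and]
    intro h
    obtain ⟨a, ha⟩ := List.length_eq_one_iff.1 h
    simp [ha]
  | succ n ih =>
    rw [pwlColoring]
    simp only [IsCliqueColor, Multiset.card_map, Finset.card_val, Multiset.mem_map, Finset.mem_val,
      forall_exists_index, and_imp, forall_apply_eq_imp_iff₂, ih]
    constructor
    · rintro ⟨hcard, hall⟩
      obtain ⟨τ₀, hτ₀⟩ := Finset.card_pos.1 ((Nat.succ_pos (n + 1)).trans_le hcard)
      have hlen : σ.1.length = n + 2 := by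
        rw [← length_add_one_of_isBoundary (mem_boundary.1 hτ₀), (hall _ hτ₀).1]
      refine ⟨hlen, ?_⟩
      intro x hx y hy hxy
      rcases Nat.eq_zero_or_pos n with rfl | hn
      · obtain ⟨a, b, hab⟩ := List.length_eq_two.1 hlen
        have hch := σ.2.2.2.1
        simp only [hab, List.isChain_pair, Set.mem_ofPred_eq, List.mem_cons, List.not_mem_nil,
          or_false] at hch hx hy
        rcases hx with rfl | rfl <;> rcases hy with rfl | rfl
        exacts [absurd rfl hxy, hch, hch.symm, absurd rfl hxy]
      · obtain ⟨i, hi, hxi, hyi⟩ := List.exists_mem_eraseIdx_of_three_le_length (by omega) hx hy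
        obtain ⟨τ, hτ, h⟩ := σ.exists_mem_boundary_of_length_le_card (hlen.trans_le hcard) hi
        refine (hall τ hτ).2 ?_ ?_ hxy <;> rcases h with h | h <;> simpa [h]
    · rintro ⟨hlen, hcl⟩
      constructor
      · have hpw : σ.1.Pairwise G.Adj := List.Pairwise.imp_of_mem
          (fun {_ _} hx hy hxy => hcl hx hy hxy) σ.2.2.1
        have hex : ∀ i : Fin (n + 2), ∃ τ : ElemPath G p,
            τ.1 = σ.1.eraseIdx i ∨ τ.1 = (σ.1.eraseIdx i).reverse := fun i => by
          have hi : (σ.1.eraseIdx i).length = n + 1 := by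
            rw [List.length_eraseIdx_of_lt (by omega)]; omega
          have := σ.2.1
          exact exists_of_isChain (List.ne_nil_of_length_pos (by omega)) (by omega)
            (σ.2.2.1.eraseIdx i) (hpw.eraseIdx i).isChain
        choose f hf using hex
        have hmem : ∀ i x, x ∈ (f i).1 ↔ x ∈ σ.1.eraseIdx i := fun i x => by
          rcases hf i with h | h <;> simp [h]
        -- Different omissions give different boundaries: only `f i` lacks the `i`-th vertex.
        have hinj : Function.Injective f := by
          intro i j hij
          by_contra hne
          have hi : (i : ℕ) < σ.1.length := by omega
          have h1 : σ.1[(i : ℕ)] ∈ (f j).1 := by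
            rw [hmem, List.mem_eraseIdx_iff_getElem]
            exact ⟨i, hi, fun h => hne (Fin.ext h), rfl⟩
          rw [← hij, hmem, List.mem_eraseIdx_iff_getElem] at h1
          obtain ⟨k, hk, hki, h⟩ := h1
          exact hki ((List.Nodup.getElem_inj_iff σ.2.2.1).1 h)
        calc n + 2 = (Finset.univ.map ⟨f, hinj⟩).card := by simp
          _ ≤ σ.boundary.card := Finset.card_le_card fun τ hτ => by
            obtain ⟨i, -, rfl⟩ := Finset.mem_map.1 hτ
            exact mem_boundary.2 ⟨i, by omega, hf i⟩
      · intro τ hτ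
        have hb := mem_boundary.1 hτ
        have := length_add_one_of_isBoundary hb
        refine ⟨by omega, hcl.subset ?_⟩
        obtain ⟨i, -, h⟩ := hb
        intro x hx
        rcases h with h | h <;> simp only [h, Set.mem_ofPred_eq, List.mem_reverse] at hx <;>
          exact List.mem_of_mem_eraseIdx hx

/-- The test distinguishes graphs with different clique numbers, provided that paths through all
vertices of a clique of the critical size are among the coloured objects. -/
theorem pwlDistinguishes_of_isNClique_of_cliqueFree {V W : Type*} [LinearOrder V] [Finite V]
    [LinearOrder W] [Finite W] {G : SimpleGraph V} {H : SimpleGraph W} {n p : ℕ} (hp : n ≤ p)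
    {s : Finset V} (hG : G.IsNClique (n + 1) s) (hH : H.CliqueFree (n + 1)) :
    PWLDistinguishes p G H := by
  refine distinguishedBy_of_colorHistogram_ne (s := n + 1)
    (fun t (x : PWLColor (t + 1)) => x.1) (fun _ _ => rfl) (fun _ _ => rfl) fun h => ?_
  have hlen : (s.sort (· ≤ ·)).length = n + 1 := by rw [Finset.length_sort, hG.card_eq]
  have hpw : (s.sort (· ≤ ·)).Pairwise G.Adj := by
    refine List.Pairwise.imp_of_mem ?_ (s.sort_nodup (· ≤ ·))
    intro a b ha hb hab
    exact hG.isClique (by simpa using ha) (by simpa using hb) hab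
  obtain ⟨σ, hσ⟩ := ElemPath.exists_of_isChain (p := p)
    (List.ne_nil_of_length_pos (by omega)) (by omega) (s.sort_nodup (· ≤ ·)) hpw.isChain
  have hmem : pwlColoring G p (n + 1) σ ∈ colorHistogram (pwlColoring H p (n + 1)) := by
    rw [← h]
    exact Multiset.mem_map_of_mem _ (Finset.mem_univ σ)
  obtain ⟨τ, -, hτ⟩ := Multiset.mem_map.1 hmem
  have hcol : IsCliqueColor n (pwlColoring G p (n + 1) σ) := by
    rw [isCliqueColor_pwlColoring_iff]
    have hset : {x | x ∈ σ.1} = (s : Set V) := by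
      ext x
      rcases hσ with h | h <;> simp [h]
    refine ⟨?_, hset ▸ hG.isClique⟩
    rcases hσ with h | h <;> simpa [h] using hlen
  rw [← hτ, isCliqueColor_pwlColoring_iff] at hcol
  refine hH τ.1.toFinset ⟨by simpa using hcol.2, ?_⟩
  rw [List.toFinset_card_of_nodup τ.2.2.1, hcol.1]

/-! ### The 3-dimensional test on strongly regular graphs -/

/-- Two pairs of vertices that are related in the same way admit a bijection of the vertices that
matches the adjacencies to the entries of the pairs. -/
theorem SimpleGraph.IsSRGWith.exists_equiv_adj_iff {V : Type*} [Fintype V] [DecidableEq V]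
    {n k l m : ℕ} {G H : SimpleGraph V} [DecidableRel G.Adj] [DecidableRel H.Adj]
    (hG : G.IsSRGWith n k l m) (hH : H.IsSRGWith n k l m) {a b a' b' : V}
    (heq : a = b ↔ a' = b') (hadj : G.Adj a b ↔ H.Adj a' b') :
    ∃ e : V ≃ V, ∀ u, (G.Adj u a ↔ H.Adj (e u) a') ∧ (G.Adj u b ↔ H.Adj (e u) b') := by
  classical
  have key : ∀ (K : SimpleGraph V) [DecidableRel K.Adj], K.IsSRGWith n k l m → ∀ x y : V,
      (Finset.univ.filter fun u => K.Adj u x ∧ K.Adj u y).card =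
        (if x = y then k else if K.Adj x y then l else m) ∧
      (Finset.univ.filter fun u => K.Adj u x).card = k := by
    intro K _ hK x y
    have hdeg : ∀ z, (Finset.univ.filter fun u => K.Adj u z).card = k := by
      intro z
      rw [← hK.regular z, ← K.card_neighborFinset_eq_degree]
      congr 1
      ext u
      simp [K.adj_comm]
    refine ⟨?_, hdeg x⟩
    by_cases hxy : x = y
    · subst hxy
      simpa using hdeg x
    · have hc : (Finset.univ.filter fun u => K.Adj u x ∧ K.Adj u y).card =
          Fintype.card (K.commonNeighbors x y) := by
        rw [← Set.toFinset_card]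
        congr 1
        ext u
        simp [SimpleGraph.mem_commonNeighbors, K.adj_comm]
      by_cases ha : K.Adj x y
      · simp [hxy, ha, hc, hK.of_adj x y ha]
      · simp [hxy, ha, hc, hK.of_not_adj hxy ha]
  -- The four classes of vertices, by adjacency to the two given vertices, have sizes that
  -- the parameters determine.
  have hcard : ∀ (K : SimpleGraph V) [DecidableRel K.Adj] (x y : V) (P Q : Prop),
      (Finset.univ.filter fun u => (K.Adj u x, K.Adj u y) = (P, Q)).card =
        (if P then if Q then (Finset.univ.filter fun u => K.Adj u x ∧ K.Adj u y).card
          else (Finset.univ.filter fun u => K.Adj u x).card -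
            (Finset.univ.filter fun u => K.Adj u x ∧ K.Adj u y).card
        else if Q then (Finset.univ.filter fun u => K.Adj u y).card -
            (Finset.univ.filter fun u => K.Adj u y ∧ K.Adj u x).card
          else Fintype.card V - (Finset.univ.filter fun u => K.Adj u x).card -
            ((Finset.univ.filter fun u => K.Adj u y).card -
            (Finset.univ.filter fun u => K.Adj u y ∧ K.Adj u x).card)) := by
    intro K _ x y P Q
    have h1 := Finset.card_filter_add_card_filter_not (s := Finset.univ.filter fun u => K.Adj u x)
      (fun u => K.Adj u y)
    have h2 := Finset.card_filter_add_card_filter_not (s := Finset.univ.filter fun u => K.Adj u y)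
      (fun u => K.Adj u x)
    have h3 := Finset.card_filter_add_card_filter_not (s := (Finset.univ : Finset V))
      (fun u => K.Adj u x)
    have h4 := Finset.card_filter_add_card_filter_not
      (s := Finset.univ.filter fun u => ¬ K.Adj u x) (fun u => K.Adj u y)
    simp only [Finset.filter_filter, Finset.card_univ] at h1 h2 h3 h4
    have h5 : (Finset.univ.filter fun u => ¬ K.Adj u x ∧ K.Adj u y) =
      Finset.univ.filter fun u => K.Adj u y ∧ ¬ K.Adj u x := by simp only [and_comm]
    rw [h5] at h4
    by_cases hP : P <;> by_cases hQ : Q <;>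
      simp only [hP, hQ, if_true, if_false, Prod.mk.injEq, eq_iff_iff, iff_true, iff_false]
    · omega
    · rw [h5]; omega
    · omega
  have hfib : ∀ c : Prop × Prop, Nonempty
      ({u // (G.Adj u a, G.Adj u b) = c} ≃ {u // (H.Adj u a', H.Adj u b') = c}) := by
    rintro ⟨P, Q⟩
    refine ⟨Fintype.equivOfCardEq ?_⟩
    rw [Fintype.card_subtype, Fintype.card_subtype, hcard, hcard, (key G hG a b).1,
      (key G hG b a).1, (key G hG a b).2, (key G hG b a).2, (key H hH a' b').1,
      (key H hH b' a').1, (key H hH a' b').2, (key H hH b' a').2]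
    simp only [eq_comm (a := b), eq_comm (a := b'), G.adj_comm b, H.adj_comm b', heq, hadj]
  refine ⟨Equiv.ofFiberEquiv fun c => (hfib c).some, fun u => ?_⟩
  simpa [Prod.ext_iff, iff_comm] using Equiv.ofFiberEquiv_map (fun c => (hfib c).some) u

/-- The bijection of `SimpleGraph.IsSRGWith.exists_equiv_adj_iff` may be chosen to
match the two given vertices too: transpositions move them into place within their classes. -/
theorem SimpleGraph.IsSRGWith.exists_equiv_eq_iff_adj_iff {V : Type*} [Fintype V] [DecidableEq V]
    {n k l m : ℕ} {G H : SimpleGraph V} [DecidableRel G.Adj] [DecidableRel H.Adj]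
    (hG : G.IsSRGWith n k l m) (hH : H.IsSRGWith n k l m) {a b a' b' : V}
    (heq : a = b ↔ a' = b') (hadj : G.Adj a b ↔ H.Adj a' b') :
    ∃ e : V ≃ V, e a = a' ∧ e b = b' ∧
      ∀ u, (G.Adj u a ↔ H.Adj (e u) a') ∧ (G.Adj u b ↔ H.Adj (e u) b') := by
  obtain ⟨e, he⟩ := hG.exists_equiv_adj_iff hH heq hadj
  -- If `x'` relates to `a'` and `b'` as `x` does to `a` and `b`, then so does `e x`, and swapping
  -- `e x` with `x'` keeps all adjacencies matched.
  have move : ∀ (e : V ≃ V), (∀ u, (G.Adj u a ↔ H.Adj (e u) a') ∧ (G.Adj u b ↔ H.Adj (e u) b')) →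
      ∀ x x' : V, (G.Adj x a ↔ H.Adj x' a') → (G.Adj x b ↔ H.Adj x' b') →
      ∀ u, (G.Adj u a ↔ H.Adj (e.trans (Equiv.swap (e x) x') u) a') ∧
        (G.Adj u b ↔ H.Adj (e.trans (Equiv.swap (e x) x') u) b') := by
    intro e he x x' hxa hxb u
    have h1 := he u
    have h2 := he x
    rw [Equiv.trans_apply, Equiv.swap_apply_def]
    split_ifs with h h' <;> simp_all
  have hea := move e he a a' (by simp) hadj
  set f := e.trans (Equiv.swap (e a) a') with hf
  have hfa : f a = a' := by simp [hf]
  have hfb := move f hea b b' (by simpa [G.adj_comm, H.adj_comm] using hadj) (by simp)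
  refine ⟨f.trans (Equiv.swap (f b) b'), ?_, by simp, hfb⟩
  rw [Equiv.trans_apply, hfa]
  by_cases hab : a = b
  · rw [← hab, hfa, ← heq.1 hab, Equiv.swap_self, Equiv.refl_apply]
  · exact Equiv.swap_apply_of_ne_of_ne (fun h => hab (f.injective (hfa.trans h)))
      (fun h => hab (heq.2 h))

theorem wlColoring_zero_eq_iff {V W : Type*} [DecidableEq V] [Fintype V] [DecidableEq W]
    [Fintype W] {G : SimpleGraph V} {H : SimpleGraph W} {k : ℕ} {v : Fin k → V} {w : Fin k → W} :
    wlColoring G k 0 v = wlColoring H k 0 w ↔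
      ∀ i j, (v i = v j ↔ w i = w j) ∧ (G.Adj (v i) (v j) ↔ H.Adj (w i) (w j)) := by
  simp only [wlColoring]
  constructor
  · intro h i j
    simpa using congrFun (congrFun h i) j
  · intro h
    funext i j
    simpa using h i j

/-- Up to symmetry, a triple has only three pairs of different positions to compare. -/
theorem wlColoring_three_zero_eq {V : Type*} [DecidableEq V] [Fintype V] {G H : SimpleGraph V}
    {v w : Fin 3 → V} (j : Fin 3)
    (h1 : v j = v (j + 1) ↔ w j = w (j + 1)) (h2 : v j = v (j + 2) ↔ w j = w (j + 2))
    (h3 : v (j + 1) = v (j + 2) ↔ w (j + 1) = w (j + 2))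
    (h4 : G.Adj (v j) (v (j + 1)) ↔ H.Adj (w j) (w (j + 1)))
    (h5 : G.Adj (v j) (v (j + 2)) ↔ H.Adj (w j) (w (j + 2)))
    (h6 : G.Adj (v (j + 1)) (v (j + 2)) ↔ H.Adj (w (j + 1)) (w (j + 2))) :
    wlColoring G 3 0 v = wlColoring H 3 0 w := by
  rw [wlColoring_zero_eq_iff]
  have hcov : ∀ i : Fin 3, i = j ∨ i = j + 1 ∨ i = j + 2 := by
    clear h1 h2 h3 h4 h5 h6; revert j; decide
  intro i i'
  have symm_eq : ∀ {x y x' y' : V}, (x = y ↔ x' = y') → (y = x ↔ y' = x') :=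
    fun h => eq_comm.trans (h.trans eq_comm)
  have symm_adj : ∀ {x y x' y' : V}, (G.Adj x y ↔ H.Adj x' y') → (G.Adj y x ↔ H.Adj y' x') :=
    fun h => (G.adj_comm _ _).trans (h.trans (H.adj_comm _ _))
  rcases hcov i with rfl | rfl | rfl <;> rcases hcov i' with rfl | rfl | rfl
  exacts [by simp, ⟨h1, h4⟩, ⟨h2, h5⟩, ⟨symm_eq h1, symm_adj h4⟩, by simp, ⟨h3, h6⟩,
    ⟨symm_eq h2, symm_adj h5⟩, ⟨symm_eq h3, symm_adj h6⟩, by simp]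

/-- On strongly regular graphs with the same parameters, the initial colouring is already stable:
how many vertices extend two entries of a triple to a triple of a given isomorphism type depends
only on the parameters and on how the two entries are related. -/
theorem SimpleGraph.IsSRGWith.wlColoring_three_eq {V : Type*} [Fintype V] [DecidableEq V]
    {n k l m : ℕ} {G H : SimpleGraph V} [DecidableRel G.Adj] [DecidableRel H.Adj]
    (hG : G.IsSRGWith n k l m) (hH : H.IsSRGWith n k l m) (t : ℕ) {v w : Fin 3 → V}
    (hvw : wlColoring G 3 0 v = wlColoring H 3 0 w) :
    wlColoring G 3 t v = wlColoring H 3 t w := by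
  induction t generalizing v w with
  | zero => exact hvw
  | succ t ih =>
    refine Prod.ext (ih hvw) (funext fun j => ?_)
    have h := wlColoring_zero_eq_iff.1 hvw
    obtain ⟨e, hea, heb, he⟩ := hG.exists_equiv_eq_iff_adj_iff hH
      (h (j + 1) (j + 2)).1 (h (j + 1) (j + 2)).2
    change Multiset.map (fun u => wlColoring G 3 t (Function.update v j u)) _ =
      Multiset.map (fun u => wlColoring H 3 t (Function.update w j u)) _
    conv_rhs => rw [← Multiset.map_univ_val_equiv e, Multiset.map_map]
    refine Multiset.map_congr rfl fun u _ => ih ?_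
    have n1 : j + 1 ≠ j := by simp
    have n2 : j + 2 ≠ j := by simp
    apply wlColoring_three_zero_eq j <;>
      simp only [Function.update_self, Function.update_of_ne n1, Function.update_of_ne n2]
    · rw [← hea, e.injective.eq_iff]
    · rw [← heb, e.injective.eq_iff]
    · exact (h _ _).1
    · exact (he u).1
    · exact (he u).2
    · exact (h _ _).2

theorem SimpleGraph.IsSRGWith.not_wlDistinguishes_three {V : Type*} [Fintype V] [DecidableEq V]
    {n k l m : ℕ} {G H : SimpleGraph V} [DecidableRel G.Adj] [DecidableRel H.Adj]
    (hG : G.IsSRGWith n k l m) (hH : H.IsSRGWith n k l m) : ¬ WLDistinguishes 3 G H := by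
  rintro ⟨t, -, ht⟩
  apply ht
  -- A bijection of triples that preserves isomorphism types: keep the first entry, and match the
  -- second and then the third entry relative to the entries before them.
  choose e he_eq _ he_adj using fun a : V =>
    hG.exists_equiv_eq_iff_adj_iff hH (a := a) (b := a) (a' := a) (b' := a) (by simp) (by simp)
  choose f hfa hfb hf using fun a b : V =>
    hG.exists_equiv_eq_iff_adj_iff hH (a := a) (b := b) (a' := a) (b' := e a b)
      (by rw [← (e a).injective.eq_iff, he_eq])
      (by rw [G.adj_comm, (he_adj a b).1, H.adj_comm])
  let F : (Fin 3 → V) → Fin 3 → V := fun v => ![v 0, e (v 0) (v 1), f (v 0) (v 1) (v 2)]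
  have hF : Function.Injective F := by
    intro v w h
    have h0 : v 0 = w 0 := congrFun h 0
    have h1 : e (v 0) (v 1) = e (w 0) (w 1) := congrFun h 1
    rw [h0, (e (w 0)).injective.eq_iff] at h1
    have h2 : f (v 0) (v 1) (v 2) = f (w 0) (w 1) (w 2) := congrFun h 2
    rw [h0, h1, (f (w 0) (w 1)).injective.eq_iff] at h2
    funext i
    fin_cases i <;> assumption
  let E := Equiv.ofBijective F (Finite.injective_iff_bijective.1 hF)
  unfold colorHistogram
  conv_rhs => rw [← Multiset.map_univ_val_equiv E, Multiset.map_map]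
  refine Multiset.map_congr rfl fun v _ => hG.wlColoring_three_eq hH t ?_
  have E0 : E v 0 = v 0 := rfl
  have E1 : E v 1 = e (v 0) (v 1) := rfl
  have E2 : E v 2 = f (v 0) (v 1) (v 2) := rfl
  apply wlColoring_three_zero_eq 2 <;>
    simp only [show (2 + 1 : Fin 3) = 0 from rfl, show (2 + 2 : Fin 3) = 1 from rfl, E0, E1, E2]
  · rw [← (f (v 0) (v 1)).injective.eq_iff, hfa]
  · rw [← hfb (v 0) (v 1), (f _ _).injective.eq_iff]
  · rw [← (e (v 0)).injective.eq_iff, he_eq]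
  · exact (hf _ _ _).1
  · exact (hf _ _ _).2
  · rw [G.adj_comm, (he_adj _ _).1, H.adj_comm]

/-! ### The rook's graph and the Shrikhande graph -/

/-- The rook's graph of the `4 × 4` board, with the field in row `r` and column `c` numbered
`4 * r + c`. -/
def rookGraph : SimpleGraph (Fin 16) where
  Adj a b := a ≠ b ∧ (a.1 / 4 = b.1 / 4 ∨ a.1 % 4 = b.1 % 4)
  symm := ⟨fun _ _ h => ⟨h.1.symm, h.2.imp Eq.symm Eq.symm⟩⟩
  loopless := ⟨fun _ h => h.1 rfl⟩

instance : DecidableRel rookGraph.Adj :=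
  fun a b => inferInstanceAs (Decidable (a ≠ b ∧ (a.1 / 4 = b.1 / 4 ∨ a.1 % 4 = b.1 % 4)))

/-- Adjacency in the Shrikhande graph, the Cayley graph of `ℤ/4 × ℤ/4` with the connection set
`±(1, 0), ±(0, 1), ±(1, 1)`. The element `(r, c)` is numbered `4 * r + c`, so that `c` is determined
modulo `4` by the number itself; multiples of `4` are added to keep the differences in `ℕ`. -/
def shrikhandeRel (a b : Fin 16) : Bool :=
  (((a.1 / 4 + 4 - b.1 / 4) % 4, (a.1 + 16 - b.1) % 4) : ℕ × ℕ) ∈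
    [(1, 0), (3, 0), (0, 1), (0, 3), (1, 1), (3, 3)]

/-- The Shrikhande graph, on the numbered elements of `ℤ/4 × ℤ/4`. -/
def shrikhandeGraph : SimpleGraph (Fin 16) where
  Adj a b := shrikhandeRel a b
  symm := ⟨by decide +kernel⟩
  loopless := ⟨by decide +kernel⟩

instance : DecidableRel shrikhandeGraph.Adj :=
  fun a b => inferInstanceAs (Decidable (shrikhandeRel a b = true))

theorem rookGraph_isSRGWith : rookGraph.IsSRGWith 16 6 2 2 where
  card := rfl
  regular := by unfold SimpleGraph.IsRegularOfDegree; decide +kernel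
  of_adj := by decide +kernel
  of_not_adj := by unfold Pairwise; decide +kernel

theorem shrikhandeGraph_isSRGWith : shrikhandeGraph.IsSRGWith 16 6 2 2 where
  card := rfl
  regular := by unfold SimpleGraph.IsRegularOfDegree; decide +kernel
  of_adj := by decide +kernel
  of_not_adj := by unfold Pairwise; decide +kernel

theorem shrikhandeGraph_not_adj_of_adj : ∀ a b, shrikhandeGraph.Adj a b →
    ∀ c, shrikhandeGraph.Adj a c → shrikhandeGraph.Adj b c →
    ∀ d, shrikhandeGraph.Adj a d → shrikhandeGraph.Adj b d → ¬ shrikhandeGraph.Adj c d := by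
  decide +kernel

theorem shrikhandeGraph_cliqueFree : shrikhandeGraph.CliqueFree 4 := by
  intro s hs
  obtain ⟨a, t, ha, rfl, ht⟩ := Finset.card_eq_succ.1 hs.card_eq
  obtain ⟨b, c, d, hbc, hbd, hcd, rfl⟩ := Finset.card_eq_three.1 ht
  have h := hs.isClique
  simp only [Finset.mem_insert, Finset.mem_singleton, not_or] at ha
  simp only [Finset.coe_insert, Finset.coe_singleton, SimpleGraph.isClique_insert,
    SimpleGraph.isClique_singleton, Set.mem_insert_iff, Set.mem_singleton_iff,
    forall_eq_or_imp, forall_eq, true_and] at h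
  exact shrikhandeGraph_not_adj_of_adj a b (h.2.1 ha.1) c (h.2.2.1 ha.2.1) (h.1.2.1 hbc)
    d (h.2.2.2 ha.2.2) (h.1.2.2 hbd) (h.1.1 hcd)

theorem rookGraph_isNClique : rookGraph.IsNClique 4 {0, 1, 2, 3} := by
  rw [SimpleGraph.isNClique_iff]
  refine ⟨?_, rfl⟩
  simp only [Finset.coe_insert, Finset.coe_singleton, SimpleGraph.isClique_insert,
    SimpleGraph.isClique_singleton, Set.mem_insert_iff, Set.mem_singleton_iff,
    forall_eq_or_imp, forall_eq, true_and]
  decide +kernel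

theorem isEmpty_rookGraph_iso_shrikhandeGraph : IsEmpty (rookGraph ≃g shrikhandeGraph) :=
  ⟨fun e => rookGraph_isNClique.not_cliqueFree
    (shrikhandeGraph_cliqueFree.comap ⟨e.toCopy⟩)⟩

theorem mainTheorem3 :
    ∃ (n k l m : ℕ) (G H : SimpleGraph (Fin n)) (_ : DecidableRel G.Adj)
      (_ : DecidableRel H.Adj),
      G.IsSRGWith n k l m ∧ H.IsSRGWith n k l m ∧ IsEmpty (G ≃g H) ∧
        (∀ p : ℕ, 3 ≤ p → PWLDistinguishes p G H) ∧
        ¬ WLDistinguishes 3 G H :=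
  ⟨16, 6, 2, 2, rookGraph, shrikhandeGraph, inferInstance, inferInstance, rookGraph_isSRGWith,
    shrikhandeGraph_isSRGWith, isEmpty_rookGraph_iso_shrikhandeGraph,
    fun _ hp => pwlDistinguishes_of_isNClique_of_cliqueFree hp rookGraph_isNClique
      shrikhandeGraph_cliqueFree,
    rookGraph_isSRGWith.not_wlDistinguishes_three shrikhandeGraph_isSRGWith⟩
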